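/- Let $(X,d,\mu)$ be a Cheeger space with exponent $p\in[1,\infty)$: $(X,d)$ is a locally compact, complete metric space and $\mu$ is a Radon measure on $X$ such that (a) (doubling) there is $C>0$ with $0<\mu(B(x,2r))\le C\mu(B(x,r))<\infty$ for all $x\in X$, $r>0$; (b) ($(p,p)$-Poincaré inequality) there are $C>0$, $\lambda\ge1$ such that for every Lipschitz $f:X\to\mathbb R$, $x\in X$ and $R>0$, $$\int_{B(x,R)}|f-f_{B(x,R)}|^p\,d\mu\le CR^p\int_{B(x,\lambda R)}(\mathrm{Lip} f)^p\,d\mu,$$ where $f_B=\frac1{\mu(B)}\int_B f\,d\mu$ and $(\mathrm{Lip} f)(y)=\limsup_{r\to0^+}\sup_{d(x,y)\le r}\frac{|f(x)-f(y)|}{r}$. For $r>0$, $f\in L^p(X,\mu)$ and $U\subseteq X$ open let $$E_{p,r}(f,U)=\frac1{r^p}\int_U\frac{1}{\mu(B(x,r))}\int_{B(x,r)}|f(y)-f(x)|^p\,d\mu(y)\,d\mu(x),$$ and let $KS^{1,p}(X)=\{f\in L^p(X,\mu):\limsup_{r\to0^+}E_{p,r}(f,X)<\infty\}$. Write $U\Subset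 V$ if $\overline U$ is compact and $\overline U\subset V$. Let $r_n>0$, $r_n\to0$, be a sequence along which $E_{p,r_n}$ $\overline\Gamma$-converges, and let $\Gamma_p(f)(U)=\Gamma_p(f,U)\in[0,\infty]$ be its $\overline\Gamma$-limit. This means that for all $f\in L^p(X,\mu)$ and all open $U,V$: (i) $\Gamma_p(f)(U)\le\liminf_n E_{p,r_n}(f_n,U)$ for every sequence $f_n\to f$ in $L^p(X,\mu)$; (ii) if $U\Subset V$, there is a sequence $f_n\to f$ in $L^p(X,\mu)$ with $\limsup_n E_{p,r_n}(f_n,U)\le\Gamma_p(f)(V)$; (iii) $\Gamma_p(f)$ is inner regular: $\Gamma_p(f)(V)=\sup\{\Gamma_p(f)(W): W\text{ open},\ W\Subset V\}$. Then for all $f,g\in KS^{1,p}(X)$, all $a,b\in\mathbb R$ and every open $U\subseteq X$, $$\Gamma_p(af+bg)(U)^{1/p}\le|a|\,\Gamma_p(f)(U)^{1/p}+|b|\,\Gamma_p(g)(U)^{1/p}.$$ -/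

import Mathlib

open Filter Topology MeasureTheory TopologicalSpace
open scoped ENNReal NNReal

namespace KorevaarSchoen

/-- The relation `U ⋐ V`: the closure of `U` is compact and contained in `V`. -/
def CompactlyInside {X : Type*} [TopologicalSpace X] (U V : Opens X) : Prop :=
  IsCompact (closure (U : Set X)) ∧ closure (U : Set X) ⊆ (V : Set X)

/-- The pointwise Lipschitz constant
`(Lip f)(y) = limsup_{r → 0+} sup_{x : d(x,y) ≤ r} |f x - f y| / r`, with values in `[0,∞]`. -/
noncomputable def pointwiseLip {X : Type*} [MetricSpace X] (f : X → ℝ) (y : X) : ℝ≥0∞ :=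
  limsup (fun r : ℝ => ⨆ (x : X) (_ : dist x y ≤ r), ENNReal.ofReal (|f x - f y| / r)) (𝓝[>] 0)

/-- The measure is doubling, with balls of positive and finite measure. -/
def IsDoubling {X : Type*} [MetricSpace X] [MeasurableSpace X] (μ : Measure X) : Prop :=
  ∃ C : ℝ≥0, ∀ (x : X) (r : ℝ), 0 < r →
    0 < μ (Metric.ball x (2 * r)) ∧
    μ (Metric.ball x (2 * r)) ≤ C * μ (Metric.ball x r) ∧
    μ (Metric.ball x r) < ∞

/-- The `(p,p)`-Poincaré inequality for Lipschitz functions, with constants that do not depend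
on the ball or on the function. -/
def PoincareInequality {X : Type*} [MetricSpace X] [MeasurableSpace X]
    (μ : Measure X) (p : ℝ≥0∞) : Prop :=
  ∃ (C : ℝ≥0) (lam : ℝ), 1 ≤ lam ∧
    ∀ f : X → ℝ, (∃ K : ℝ≥0, LipschitzWith K f) → ∀ (x : X) (R : ℝ), 0 < R →
      ∫⁻ y in Metric.ball x R, ‖f y - ⨍ z in Metric.ball x R, f z ∂μ‖ₑ ^ p.toReal ∂μ
        ≤ C * ENNReal.ofReal R ^ p.toReal *
          ∫⁻ y in Metric.ball x (lam * R), pointwiseLip f y ^ p.toReal ∂μ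

/-- The localized Korevaar-Schoen energy
`E_{p,r}(f,U) = r^{-p} ∫_U ⨍_{B(x,r)} |f(y)-f(x)|^p dμ(y) dμ(x)`, with values in `[0,∞]`. -/
noncomputable def localEnergy {X : Type*} [MetricSpace X] [MeasurableSpace X]
    (μ : Measure X) (p : ℝ≥0∞) (r : ℝ) (f : Lp ℝ p μ) (U : Opens X) : ℝ≥0∞ :=
  (ENNReal.ofReal r ^ p.toReal)⁻¹ *
    ∫⁻ x in (U : Set X), (⨍⁻ y in Metric.ball x r, ‖f y - f x‖ₑ ^ p.toReal ∂μ) ∂μ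

/-- The Korevaar-Schoen space `KS^{1,p}(X)` of those `f ∈ L^p(X,μ)` such that
`limsup_{r → 0+} E_{p,r}(f) < ∞`, where `E_{p,r}(f) = E_{p,r}(f,X)`. -/
def KS {X : Type*} [MetricSpace X] [MeasurableSpace X]
    (μ : Measure X) (p : ℝ≥0∞) : Set (Lp ℝ p μ) :=
  {f | limsup (fun r : ℝ => localEnergy μ p r f ⊤) (𝓝[>] 0) < ∞}

/-- `F` is the `Γ̄`-limit of the sequence `E n` of functionals on `Y × Opens X`: the lower bound
holds on every open set, recovery sequences exist on every open set that is compactly inside, and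
`F` is inner regular. Inner regularity (the `Γ̄`-limit is by definition the common inner regular
envelope of the `Γ`-lower and the `Γ`-upper limit) is what makes the limit unique; monotonicity in
the open set is a consequence of it. -/
structure IsGammaBarLimit {X Y : Type*} [TopologicalSpace X] [TopologicalSpace Y]
    (E : ℕ → Y → Opens X → ℝ≥0∞) (F : Y → Opens X → ℝ≥0∞) : Prop where
  le_liminf : ∀ (f : Y) (U : Opens X) (u : ℕ → Y), Tendsto u atTop (𝓝 f) →
    F f U ≤ liminf (fun n => E n (u n) U) atTop
  exists_recovery : ∀ (f : Y) (U V : Opens X), CompactlyInside U V →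
    ∃ u : ℕ → Y, Tendsto u atTop (𝓝 f) ∧ limsup (fun n => E n (u n) U) atTop ≤ F f V
  inner_regular : ∀ (f : Y) (V : Opens X),
    F f V = ⨆ (U : Opens X) (_ : CompactlyInside U V), F f U

end KorevaarSchoen

namespace KorevaarSchoen

/-! At a fixed radius, the `1/p`-th power of the energy is, up to a constant factor, a mixed `L^p`
seminorm of `f y - f x`. Minkowski, used in `y` over the ball and then in `x` over `U`, gives the
inequality there (`localEnergy_combination_rpow_le`). It passes to the limit
(`IsGammaBarLimit.rpow_combination_le`) because combining recovery sequences of `f` and `g` gives an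
admissible, not necessarily optimal, sequence for `a • f + b • g`. Doubling serves only
measurability: it yields σ-finiteness and second countability. -/

theorem limsup_add_le_add_limsup {ι : Type*} (l : Filter ι) (u v : ι → ℝ≥0∞) :
    limsup (fun i => u i + v i) l ≤ limsup u l + limsup v l := by
  refine ENNReal.le_of_forall_pos_le_add fun ε hε hfin => ?_
  obtain ⟨hu, hv⟩ := ENNReal.add_lt_top.1 hfin
  have hε' : (ε / 2 : ℝ≥0∞) ≠ 0 := by simpa using hε.ne'
  have hu' := eventually_lt_of_limsup_lt (ENNReal.lt_add_right hu.ne hε')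
  have hv' := eventually_lt_of_limsup_lt (ENNReal.lt_add_right hv.ne hε')
  refine limsup_le_of_le (h := ?_)
  filter_upwards [hu', hv'] with i hi hj
  calc u i + v i ≤ (limsup u l + ε / 2) + (limsup v l + ε / 2) := add_le_add hi.le hj.le
    _ = limsup u l + limsup v l + ε := by
      rw [add_add_add_comm, ENNReal.add_halves]

section Measure

variable {X : Type*} [MetricSpace X] [MeasurableSpace X] {μ : Measure X}

theorem IsDoubling.measure_ball_pos (h : IsDoubling μ) (x : X) {s : ℝ} (hs : 0 < s) :
    0 < μ (Metric.ball x s) := by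
  obtain ⟨C, hC⟩ := h
  simpa [mul_div_cancel₀] using (hC x (s / 2) (half_pos hs)).1

theorem IsDoubling.measure_ball_lt_top (h : IsDoubling μ) (x : X) {s : ℝ} (hs : 0 < s) :
    μ (Metric.ball x s) < ∞ := by
  obtain ⟨C, hC⟩ := h
  exact (hC x s hs).2.2

theorem IsDoubling.sigmaFinite (h : IsDoubling μ) : SigmaFinite μ := by
  rcases isEmpty_or_nonempty X with hX | ⟨⟨x⟩⟩
  · rw [Measure.eq_zero_of_isEmpty μ]
    infer_instance
  · refine ⟨⟨⟨fun n => Metric.ball x (n + 1), fun _ => trivial,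
      fun n => h.measure_ball_lt_top x (by positivity), ?_⟩⟩⟩
    refine Set.eq_univ_of_forall fun y => Set.mem_iUnion.2 ?_
    obtain ⟨n, hn⟩ := exists_nat_gt (dist y x)
    exact ⟨n, by rw [Metric.mem_ball]; linarith⟩

/-- A metric space carrying a doubling measure is separable: a maximal separated set is the set
of centres of a disjoint family of balls of positive measure. -/
theorem IsDoubling.secondCountableTopology [OpensMeasurableSpace X] (h : IsDoubling μ) :
    SecondCountableTopology X := by
  have := h.sigmaFinite
  refine Metric.secondCountable_of_almost_dense_set fun ε hε => ?_
  obtain ⟨s, hs⟩ := zorn_subset {t : Set X | t.Pairwise fun x y => ε ≤ dist x y} fun c hc hchain =>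
    ⟨⋃₀ c, (Set.pairwise_sUnion hchain.directedOn).2 fun t ht => hc ht,
      fun t ht => Set.subset_sUnion_of_mem ht⟩
  refine ⟨s, ?_, fun x => ?_⟩
  · have hdisj : Pairwise (Function.onFun Disjoint fun x : s => Metric.ball (x : X) (ε / 2)) := by
      intro x y hxy
      refine Metric.ball_disjoint_ball ?_
      rw [add_halves]
      exact hs.prop x.2 y.2 (Subtype.coe_injective.ne hxy)
    -- By σ-finiteness, only countably many disjoint balls can have positive measure.
    have hcount := Measure.countable_meas_pos_of_disjoint_iUnion (μ := μ)
      (fun x : s => Metric.isOpen_ball.measurableSet) hdisj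
    simpa [h.measure_ball_pos _ (half_pos hε), Set.countable_univ_iff] using hcount
  · by_contra! hx
    have hins : insert x s ∈ {t : Set X | t.Pairwise fun x y => ε ≤ dist x y} := by
      refine Set.Pairwise.insert hs.prop fun y hy _ => ⟨(hx y hy).le, ?_⟩
      rw [dist_comm]
      exact (hx y hy).le
    have hxs : x ∈ s := hs.le_of_ge hins (Set.subset_insert x s) (Set.mem_insert x s)
    have := hx x hxs
    rw [dist_self] at this
    exact this.not_ge hε.le

theorem lintegral_rpow_combination_le {Y : Type*} [MeasurableSpace Y] {ν : Measure Y} {q : ℝ}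
    (hq : 1 ≤ q) {F G : Y → ℝ≥0∞} (hF : AEMeasurable F ν) (hG : AEMeasurable G ν) (a b : ℝ≥0∞)
    (ha : a ≠ ∞) (hb : b ≠ ∞) :
    (∫⁻ y, (a * F y + b * G y) ^ q ∂ν) ^ (1 / q)
      ≤ a * (∫⁻ y, F y ^ q ∂ν) ^ (1 / q) + b * (∫⁻ y, G y ^ q ∂ν) ^ (1 / q) := by
  have hq0 : 0 < q := by linarith
  have key : ∀ (c : ℝ≥0∞) (H : Y → ℝ≥0∞), c ≠ ∞ →
      (∫⁻ y, (c * H y) ^ q ∂ν) ^ (1 / q) = c * (∫⁻ y, H y ^ q ∂ν) ^ (1 / q) := by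
    intro c H hc
    simp_rw [ENNReal.mul_rpow_of_nonneg _ _ hq0.le]
    rw [lintegral_const_mul' _ _ (ENNReal.rpow_ne_top_of_nonneg hq0.le hc),
      ENNReal.mul_rpow_of_nonneg _ _ (by positivity), ← ENNReal.rpow_mul,
      mul_one_div_cancel hq0.ne', ENNReal.rpow_one]
  rw [← key a F ha, ← key b G hb]
  exact ENNReal.lintegral_Lp_add_le (hF.const_mul a) (hG.const_mul b) hq

theorem measurable_setLAverage_ball [OpensMeasurableSpace X] [SecondCountableTopology X]
    [SFinite μ] (s : ℝ) {H : X → X → ℝ≥0∞} (hH : Measurable (Function.uncurry H)) :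
    Measurable fun x => ⨍⁻ y in Metric.ball x s, H x y ∂μ := by
  -- Second countability makes this open set measurable for the product σ-algebra, so Tonelli
  -- applies to its indicator.
  have hset : MeasurableSet {z : X × X | dist z.2 z.1 < s} :=
    (isOpen_lt (continuous_snd.dist continuous_fst) continuous_const).measurableSet
  have hball : ∀ x : X, MeasurableSet (Metric.ball x s) :=
    fun _ => Metric.isOpen_ball.measurableSet
  have hint : ∀ K : X → X → ℝ≥0∞, Measurable (Function.uncurry K) →
      Measurable fun x => ∫⁻ y in Metric.ball x s, K x y ∂μ := by
    intro K hK
    simp_rw [← lintegral_indicator (hball _)]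
    exact (hK.indicator hset).lintegral_prod_right'
  simp_rw [setLAverage_eq]
  refine (hint H hH).div ?_
  simpa using hint (fun _ _ => 1) measurable_const

theorem localEnergy_combination_rpow_le [OpensMeasurableSpace X] [SecondCountableTopology X]
    [SFinite μ] {p : ℝ≥0∞} (hp1 : 1 ≤ p) (hp : p ≠ ∞) (s : ℝ) (f g : Lp ℝ p μ)
    (a b : ℝ) (U : Opens X) :
    localEnergy μ p s (a • f + b • g) U ^ (1 / p.toReal)
      ≤ ENNReal.ofReal |a| * localEnergy μ p s f U ^ (1 / p.toReal)
        + ENNReal.ofReal |b| * localEnergy μ p s g U ^ (1 / p.toReal) := by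
  have hq : 1 ≤ p.toReal := by simpa using ENNReal.toReal_mono hp hp1
  set q := p.toReal
  have hq0 : 0 < q := by linarith
  have hq0' : 0 ≤ 1 / q := by positivity
  have hroot : ∀ c : ℝ≥0∞, (c ^ (1 / q)) ^ q = c := fun c => by
    rw [← ENNReal.rpow_mul, one_div_mul_cancel hq0.ne', ENNReal.rpow_one]
  -- The inner seminorm, in `y`; the outer Minkowski inequality is applied to it as a function of
  -- `x`.
  let N : (X → ℝ) → X → ℝ≥0∞ := fun u x =>
    (⨍⁻ y in Metric.ball x s, ‖u y - u x‖ₑ ^ q ∂μ) ^ (1 / q)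
  have hN : ∀ u : Lp ℝ p μ, localEnergy μ p s u U
      = (ENNReal.ofReal s ^ q)⁻¹ * ∫⁻ x in (U : Set X), N u x ^ q ∂μ := by
    intro u
    simp only [N, hroot]
    rfl
  have hNmeas : ∀ u : Lp ℝ p μ, Measurable (N u) := by
    intro u
    have hu : Measurable u := (Lp.stronglyMeasurable u).measurable
    refine (measurable_setLAverage_ball s (H := fun x y => ‖u y - u x‖ₑ ^ q) ?_).pow_const _
    exact ((hu.comp measurable_snd).sub (hu.comp measurable_fst)).enorm.pow_const q
  have hcoe : ∀ᵐ x ∂μ, (a • f + b • g : Lp ℝ p μ) x = a * f x + b * g x := by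
    filter_upwards [Lp.coeFn_add (a • f) (b • g), Lp.coeFn_smul a f, Lp.coeFn_smul b g]
      with x h1 h2 h3
    rw [h1, Pi.add_apply, h2, h3]
    rfl
  have hle : ∀ᵐ x ∂μ, N (a • f + b • g : Lp ℝ p μ) x
      ≤ ENNReal.ofReal |a| * N f x + ENNReal.ofReal |b| * N g x := by
    filter_upwards [hcoe] with x hx
    have hmeas : ∀ u : Lp ℝ p μ, Measurable fun y => ‖u y - u x‖ₑ := fun u =>
      ((Lp.stronglyMeasurable u).measurable.sub_const _).enorm
    refine le_trans (ENNReal.rpow_le_rpow ?_ hq0') (lintegral_rpow_combination_le hq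
      (hmeas f).aemeasurable (hmeas g).aemeasurable _ _ ENNReal.ofReal_ne_top
      ENNReal.ofReal_ne_top)
    -- The average is the integral against the rescaled restriction of `μ`, so null sets of `μ` stay
    -- negligible.
    refine lintegral_mono_ae (Measure.ae_smul_measure ?_ _)
    filter_upwards [ae_restrict_of_ae hcoe] with y hy
    refine ENNReal.rpow_le_rpow ?_ hq0.le
    rw [hx, hy, ← Real.enorm_eq_ofReal_abs, ← Real.enorm_eq_ofReal_abs, ← enorm_mul, ← enorm_mul]
    calc ‖a * f y + b * g y - (a * f x + b * g x)‖ₑ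
        = ‖a * (f y - f x) + b * (g y - g x)‖ₑ := by ring_nf
      _ ≤ _ := enorm_add_le _ _
  have hmink := le_trans
    (ENNReal.rpow_le_rpow (lintegral_mono_ae (ae_restrict_of_ae (s := (U : Set X)) (hle.mono
      fun x hx => ENNReal.rpow_le_rpow hx hq0.le))) hq0')
    (lintegral_rpow_combination_le hq (hNmeas f).aemeasurable (hNmeas g).aemeasurable
      (ENNReal.ofReal |a|) (ENNReal.ofReal |b|) ENNReal.ofReal_ne_top ENNReal.ofReal_ne_top)
  simp only [hN, ENNReal.mul_rpow_of_nonneg _ _ hq0']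
  refine (mul_le_mul_right hmink _).trans_eq ?_
  ring

end Measure

/-- Recovery on `W` costs the value on a larger set `U`. Inner regularity absorbs this loss: it
suffices to bound the left side on every `W` compactly inside `U`. -/
theorem IsGammaBarLimit.rpow_combination_le {X Y : Type*} [TopologicalSpace X]
    [TopologicalSpace Y] [AddCommGroup Y] [Module ℝ Y] [ContinuousAdd Y] [ContinuousConstSMul ℝ Y]
    {E : ℕ → Y → Opens X → ℝ≥0∞} {F : Y → Opens X → ℝ≥0∞} (hF : IsGammaBarLimit E F)
    {t : ℝ} (ht : 0 < t) (a b : ℝ)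
    (hE : ∀ n f g U, E n (a • f + b • g) U ^ t
      ≤ ENNReal.ofReal |a| * E n f U ^ t + ENNReal.ofReal |b| * E n g U ^ t)
    (f g : Y) (U : Opens X) :
    F (a • f + b • g) U ^ t
      ≤ ENNReal.ofReal |a| * F f U ^ t + ENNReal.ofReal |b| * F g U ^ t := by
  have hlimsup : ∀ w : ℕ → ℝ≥0∞, limsup (fun n => w n ^ t) atTop = limsup w atTop ^ t := fun w =>
    ((ENNReal.orderIsoRpow t ht).limsup_apply (u := w) (f := atTop)).symm
  -- Moving the power to the right leaves a bare supremum on the left.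
  rw [← ENNReal.le_rpow_inv_iff ht, hF.inner_regular _ U]
  refine iSup₂_le fun W hW => (ENNReal.le_rpow_inv_iff ht).2 ?_
  obtain ⟨u, hu, hfu⟩ := hF.exists_recovery f W U hW
  obtain ⟨v, hv, hgv⟩ := hF.exists_recovery g W U hW
  calc F (a • f + b • g) W ^ t
      ≤ limsup (fun n => E n (a • u n + b • v n) W) atTop ^ t :=
        ENNReal.rpow_le_rpow ((hF.le_liminf _ W _ ((hu.const_smul a).add (hv.const_smul b))).trans
          liminf_le_limsup) ht.le
    _ = limsup (fun n => E n (a • u n + b • v n) W ^ t) atTop := (hlimsup _).symm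
    _ ≤ limsup (fun n => ENNReal.ofReal |a| * E n (u n) W ^ t
          + ENNReal.ofReal |b| * E n (v n) W ^ t) atTop :=
        limsup_le_limsup (Eventually.of_forall fun n => hE n _ _ W)
    _ ≤ limsup (fun n => ENNReal.ofReal |a| * E n (u n) W ^ t) atTop
          + limsup (fun n => ENNReal.ofReal |b| * E n (v n) W ^ t) atTop :=
        limsup_add_le_add_limsup _ _ _
    _ = ENNReal.ofReal |a| * limsup (fun n => E n (u n) W) atTop ^ t
          + ENNReal.ofReal |b| * limsup (fun n => E n (v n) W) atTop ^ t := by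
        rw [ENNReal.limsup_const_mul_of_ne_top ENNReal.ofReal_ne_top,
          ENNReal.limsup_const_mul_of_ne_top ENNReal.ofReal_ne_top, hlimsup, hlimsup]
    _ ≤ _ := by gcongr

end KorevaarSchoen

/-- The Minkowski inequality for Korevaar-Schoen `p`-energy measures on a Cheeger space. Here
`Γp f U` is the value on the open set `U` of the energy measure of `f`, that is, of the `Γ̄`-limit
of the localized Korevaar-Schoen energies along a sequence of radii `r n → 0`. -/
theorem propositionP {X : Type*} [MetricSpace X] [CompleteSpace X] [LocallyCompactSpace X]
    [MeasurableSpace X] [BorelSpace X] (μ : Measure X) [μ.Regular]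
    (p : ℝ≥0∞) [Fact (1 ≤ p)] (hp : p ≠ ∞)
    (hdoubling : KorevaarSchoen.IsDoubling μ)
    (hpoincare : KorevaarSchoen.PoincareInequality μ p)
    (r : ℕ → ℝ) (hr_pos : ∀ n, 0 < r n) (hr_lim : Tendsto r atTop (𝓝 0))
    (Γp : Lp ℝ p μ → Opens X → ℝ≥0∞)
    (hΓp : KorevaarSchoen.IsGammaBarLimit
      (fun n => KorevaarSchoen.localEnergy μ p (r n)) Γp)
    (f g : Lp ℝ p μ) (hf : f ∈ KorevaarSchoen.KS μ p) (hg : g ∈ KorevaarSchoen.KS μ p)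
    (a b : ℝ) (U : Opens X) :
    Γp (a • f + b • g) U ^ (1 / p.toReal)
      ≤ ENNReal.ofReal |a| * Γp f U ^ (1 / p.toReal)
        + ENNReal.ofReal |b| * Γp g U ^ (1 / p.toReal) := by
  have := hdoubling.sigmaFinite
  have := hdoubling.secondCountableTopology
  have hp1 : 1 ≤ p := Fact.out
  refine hΓp.rpow_combination_le
    (one_div_pos.2 (ENNReal.toReal_pos (zero_lt_one.trans_le hp1).ne' hp)) a b
    (fun n f g U => ?_) f g U
  exact KorevaarSchoen.localEnergy_combination_rpow_le hp1 hp (r n) f g a b U
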